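/- For complex $p,q$ let the derivative of order $p$ of $z^q$ be $D^{(p)}z^q=\frac{\Gamma(1+q)}{\Gamma(1+q-p)}z^{q-p}$ (principal branch, with $1/\Gamma=0$ at the poles of $\Gamma$), and for a function given by its Maclaurin series let $D^{(p)}$ be applied term by term. (If $\operatorname{Re}p<0$ this is an antiderivative.) A gauge function of order $p$ is a function $G(z)=z^{-p}(c_1z^{-1}+\dots+c_kz^{-k})$ with $c_1,\dots,c_k\in\mathbb C$, where $k=\lfloor-\operatorname{Re}p\rfloor$ if $\operatorname{Re}p\le-1$, and $G=0$ if $\operatorname{Re}p>-1$. Such functions satisfy $D^{(-p)}G=0$ and play the role of integration constants. Let $p\in\mathbb C$. Then for all complex $z\neq0$ the following series converge and $$D^{(p)}\sin z=\sum_{m=0}^\infty\frac{(-1)^m z^{2m+1-p}}{\Gamma(2m+2-p)},\qquad D^{(p)}\cos z=\sum_{m=0}^\infty\frac{(-1)^m z^{2m-p}}{\Gamma(2m+1-p)}.$$ As $x\to+\infty$ through the reals, these functions approach phase-shifted circular functions: $$D^{(p)}\sin x-\sin\!\left(x+\tfrac{p\pi}2\right)\to0\quad\text{if }\operatorname{Re}p>-1,\qquad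 D^{(p)}\cos x-\cos\!\left(x+\tfrac{p\pi}2\right)\to0\quad\text{if }\operatorname{Re}p>-2.$$ For every $p\in\mathbb C$ the same holds up to a gauge function: there are gauge functions $G_1,G_2$ of order $p$ with $$D^{(p)}\sin x+G_1(x)-\sin\!\left(x+\tfrac{p\pi}2\right)\to0,\qquad D^{(p)}\cos x+G_2(x)-\cos\!\left(x+\tfrac{p\pi}2\right)\to0\qquad(x\to+\infty).$$ -/

import Mathlib

open Filter Topology

/-- The derivative of complex order `p` of the power `z ↦ z ^ q`, namely
`Γ(1+q) / Γ(1+q-p) * z ^ (q-p)` (principal branch).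
Where `1+q-p` is a pole of `Γ`, Mathlib's `Gamma` is `0`, so that the quotient is `0`, which is
the value of the entire function `1/Γ` there. -/
noncomputable def powerDeriv (p q z : ℂ) : ℂ :=
  Complex.Gamma (1 + q) / Complex.Gamma (1 + q - p) * z ^ (q - p)

/-- The derivative of complex order `p` (an antiderivative if `p.re < 0`) of a function with
Maclaurin series `∑ aₙ zⁿ`, `aₙ = f⁽ⁿ⁾(0) / n!`: the power rule is applied to every term. -/
noncomputable def complexOrderDeriv (p : ℂ) (f : ℂ → ℂ) (z : ℂ) : ℂ :=
  ∑' n : ℕ, iteratedDeriv n f 0 / (n.factorial : ℂ) * powerDeriv p n z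

/-- The gauge functions ("integration constants") of order `p`:
`G(z) = z ^ (-p) * (c₁ z⁻¹ + ⋯ + c_k z ^ (-k))`, with `k` the greatest integer `≤ -Re p`.
If `-1 < Re p` the sum is empty and `G = 0`. -/
def IsGaugeFunction (p : ℂ) (G : ℂ → ℂ) : Prop :=
  ∃ c : ℕ → ℂ, ∀ z : ℂ, G z = ∑ j ∈ Finset.Icc 1 ⌊-p.re⌋₊, c j * z ^ (-p - (j : ℂ))

/-- The powers that occur in a gauge function of order `p` are annihilated by the
derivative of order `-p`. -/
theorem powerDeriv_gauge (p z : ℂ) (j : ℕ) (hj : 1 ≤ j) :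
    powerDeriv (-p) (-p - (j : ℂ)) z = 0 := by
  obtain ⟨i, rfl⟩ := Nat.exists_eq_add_of_le hj
  have h : (1 + (-p - ((1 + i : ℕ) : ℂ)) - -p) = -(i : ℂ) := by push_cast; ring
  rw [powerDeriv, h, Complex.Gamma_neg_nat_eq_zero, div_zero, zero_mul]

/-- There is no nonzero gauge function of order `p` if `-1 < Re p`. -/
theorem IsGaugeFunction.eq_zero {p : ℂ} {G : ℂ → ℂ} (hG : IsGaugeFunction p G)
    (hp : -1 < p.re) : G = 0 := by
  obtain ⟨c, hc⟩ := hG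
  have h : ⌊-p.re⌋₊ = 0 := Nat.floor_eq_zero.2 (by linarith)
  funext z
  simp [hc, h]

/-! Both functions reduce to `cosSeries`, since the sine of order `p` gives `cosSeries (p - 1)`. For
`-2 < Re p` and `x > 0` the theorem rests on the exact formula `cosSeries p x = cos (x + pπ/2) + sin
(πp)/π * ∫₀^∞ t^(p+1) e^(-xt) / (1+t²) dt`, whose integral is `O(x^(-Re p - 2))`
(`cosSeries_eq_cos_add_expMellin`, `tendsto_expMellin_atTop`). On the strip `-2 < Re p < -1` the
difference of the two sides solves `h'' = -h` and vanishes at `0+` with its derivative, so it is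
zero; Euler's reflection formula supplies the matching constants. Both sides are holomorphic in `p`,
so the identity theorem extends the formula to `-2 < Re p`. For lower orders, `cosSeries_eq_sub`
raises the order by 2 at the cost of one power of `x`. Each power so produced either occurs in a
gauge function and can be cancelled, or tends to 0. -/

/-! ### The power series and its convergence. -/

/-- The terms of the series of the derivative of order `p` of the cosine. -/
noncomputable def cosTerm (p z : ℂ) (m : ℕ) : ℂ :=
  (-1) ^ m * z ^ (2 * (m : ℂ) - p) / Complex.Gamma (2 * (m : ℂ) + 1 - p)

/-- The series of the derivative of order `p` of the cosine. -/
noncomputable def cosSeries (p z : ℂ) : ℂ := ∑' m, cosTerm p z m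

/-- The relation `1/Γ(s) = s/Γ(s+1)` also holds at the poles; the factors stay on the left because
they may vanish. -/
theorem cosTerm_succ (p : ℂ) {z : ℂ} (hz : z ≠ 0) (m : ℕ) :
    cosTerm p z (m + 1) * ((2 * m + 2 - p) * (2 * m + 1 - p)) = -z ^ 2 * cosTerm p z m := by
  have h1 := Complex.one_div_Gamma_eq_self_mul_one_div_Gamma_add_one (2 * (m : ℂ) + 1 - p)
  have h2 := Complex.one_div_Gamma_eq_self_mul_one_div_Gamma_add_one (2 * (m : ℂ) + 1 - p + 1)
  have e1 : 2 * ((m + 1 : ℕ) : ℂ) + 1 - p = 2 * (m : ℂ) + 1 - p + 1 + 1 := by push_cast; ring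
  have e2 : 2 * ((m + 1 : ℕ) : ℂ) - p = (2 * (m : ℂ) - p) + (2 : ℕ) := by push_cast; ring
  rw [cosTerm, cosTerm, e1, e2, Complex.cpow_add _ _ hz, Complex.cpow_natCast, div_eq_mul_inv,
    div_eq_mul_inv, h1, h2]
  ring

theorem summable_cosTerm (p : ℂ) {z : ℂ} (hz : z ≠ 0) : Summable (cosTerm p z) := by
  refine summable_of_ratio_norm_eventually_le (r := 1 / 2) (by norm_num) ?_
  -- Beyond `N` both linear factors are at least `m` in norm, and `m² ≥ m ≥ 2‖z‖²` gives the ratio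
  -- `1/2`.
  obtain ⟨N, hN⟩ := exists_nat_ge (‖p‖ + 2 * ‖z‖ ^ 2 + 1)
  filter_upwards [eventually_ge_atTop N] with m hm
  have hm' : ‖p‖ + 2 * ‖z‖ ^ 2 + 1 ≤ m := hN.trans (by exact_mod_cast hm)
  have hp := norm_nonneg p
  have hzz := sq_nonneg ‖z‖
  have h1 : (m : ℝ) ≤ ‖2 * (m : ℂ) + 1 - p‖ := by
    have := norm_sub_norm_le (2 * (m : ℂ) + 1) p
    have h : ‖2 * (m : ℂ) + 1‖ = 2 * m + 1 := by
      rw [show (2 * (m : ℂ) + 1) = ((2 * m + 1 : ℕ) : ℂ) by push_cast; ring, Complex.norm_natCast]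
      push_cast; ring
    linarith
  have h2 : (m : ℝ) ≤ ‖2 * (m : ℂ) + 2 - p‖ := by
    have := norm_sub_norm_le (2 * (m : ℂ) + 2) p
    have h : ‖2 * (m : ℂ) + 2‖ = 2 * m + 2 := by
      rw [show (2 * (m : ℂ) + 2) = ((2 * m + 2 : ℕ) : ℂ) by push_cast; ring, Complex.norm_natCast]
      push_cast; ring
    linarith
  have h3 : 2 * ‖z‖ ^ 2 ≤ ‖2 * (m : ℂ) + 2 - p‖ * ‖2 * (m : ℂ) + 1 - p‖ := by
    nlinarith
  have h4 := congrArg norm (cosTerm_succ p hz m)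
  simp only [norm_mul, norm_neg, norm_pow] at h4
  have hz' : 0 < ‖z‖ ^ 2 := by positivity
  have h5 : ‖cosTerm p z (m + 1)‖ * (2 * ‖z‖ ^ 2) ≤ ‖z‖ ^ 2 * ‖cosTerm p z m‖ :=
    (mul_le_mul_of_nonneg_left h3 (norm_nonneg _)).trans_eq h4
  nlinarith

theorem cosTerm_add_one_eq (p z : ℂ) (m : ℕ) : cosTerm p z (m + 1) = -cosTerm (p - 2) z m := by
  rw [cosTerm, cosTerm, show 2 * ((m + 1 : ℕ) : ℂ) - p = 2 * m - (p - 2) by push_cast; ring,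
    show 2 * ((m + 1 : ℕ) : ℂ) + 1 - p = 2 * m + 1 - (p - 2) by push_cast; ring]
  ring

theorem cosSeries_eq_sub (p : ℂ) {z : ℂ} (hz : z ≠ 0) :
    cosSeries p z = z ^ (-p) / Complex.Gamma (1 - p) - cosSeries (p - 2) z := by
  rw [cosSeries, (summable_cosTerm p hz).tsum_eq_zero_add]
  simp only [cosTerm_add_one_eq, tsum_neg, cosSeries, sub_eq_add_neg]
  simp [cosTerm, sub_eq_add_neg]

theorem hasSum_complexOrderDeriv_cos (p : ℂ) {z : ℂ} (hz : z ≠ 0) :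
    HasSum (cosTerm p z) (complexOrderDeriv p Complex.cos z) := by
  have hinj : Function.Injective (fun m : ℕ => 2 * m) := fun a b h => by simpa using h
  set g : ℕ → ℂ := fun n =>
    iteratedDeriv n Complex.cos 0 / (n.factorial : ℂ) * powerDeriv p n z with hg
  have h0 : ∀ n ∉ Set.range (fun m : ℕ => 2 * m), g n = 0 := by
    intro n hn
    rcases Nat.even_or_odd' n with ⟨k, rfl | rfl⟩
    · exact absurd ⟨k, rfl⟩ hn
    · simp only [hg, Complex.iteratedDeriv_odd_cos]; simp
  have h1 : g ∘ (fun m : ℕ => 2 * m) = cosTerm p z := by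
    funext m
    have hf : ((2 * m).factorial : ℂ) ≠ 0 := by exact_mod_cast (2 * m).factorial_ne_zero
    simp only [hg, Function.comp, Complex.iteratedDeriv_even_cos, powerDeriv, cosTerm]
    rw [show (1 + ((2 * m : ℕ) : ℂ)) = ((2 * m : ℕ) : ℂ) + 1 by ring, Complex.Gamma_nat_eq_factorial]
    simp only [Pi.mul_apply, Pi.pow_apply, Pi.neg_apply, Pi.one_apply, Complex.cos_zero]
    push_cast
    field_simp
  have h2 : Summable g := by
    rw [← hinj.summable_iff h0, h1]; exact summable_cosTerm p hz
  have h3 : HasSum g (complexOrderDeriv p Complex.cos z) := h2.hasSum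
  rw [← hinj.hasSum_iff h0, h1] at h3
  exact h3

theorem hasSum_complexOrderDeriv_sin (p : ℂ) {z : ℂ} (hz : z ≠ 0) :
    HasSum (cosTerm (p - 1) z) (complexOrderDeriv p Complex.sin z) := by
  have hinj : Function.Injective (fun m : ℕ => 2 * m + 1) := fun a b h => by simpa using h
  set g : ℕ → ℂ := fun n =>
    iteratedDeriv n Complex.sin 0 / (n.factorial : ℂ) * powerDeriv p n z with hg
  have h0 : ∀ n ∉ Set.range (fun m : ℕ => 2 * m + 1), g n = 0 := by
    intro n hn
    rcases Nat.even_or_odd' n with ⟨k, rfl | rfl⟩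
    · simp only [hg, Complex.iteratedDeriv_even_sin]; simp
    · exact absurd ⟨k, rfl⟩ hn
  have h1 : g ∘ (fun m : ℕ => 2 * m + 1) = cosTerm (p - 1) z := by
    funext m
    have hf : ((2 * m + 1).factorial : ℂ) ≠ 0 := by exact_mod_cast (2 * m + 1).factorial_ne_zero
    simp only [hg, Function.comp, Complex.iteratedDeriv_odd_sin, powerDeriv, cosTerm]
    rw [show (1 + ((2 * m + 1 : ℕ) : ℂ)) = ((2 * m + 1 : ℕ) : ℂ) + 1 by ring,
      Complex.Gamma_nat_eq_factorial,
      show 2 * (m : ℂ) - (p - 1) = ((2 * m + 1 : ℕ) : ℂ) - p by push_cast; ring,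
      show 2 * (m : ℂ) + 1 - (p - 1) = ((2 * m + 1 : ℕ) : ℂ) + 1 - p by push_cast; ring]
    simp only [Pi.mul_apply, Pi.pow_apply, Pi.neg_apply, Pi.one_apply, Complex.cos_zero]
    field_simp
  have h2 : Summable g := by
    rw [← hinj.summable_iff h0, h1]; exact summable_cosTerm _ hz
  have h3 : HasSum g (complexOrderDeriv p Complex.sin z) := h2.hasSum
  rw [← hinj.hasSum_iff h0, h1] at h3
  exact h3

theorem complexOrderDeriv_cos (p : ℂ) {z : ℂ} (hz : z ≠ 0) :
    complexOrderDeriv p Complex.cos z = cosSeries p z :=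
  (hasSum_complexOrderDeriv_cos p hz).tsum_eq.symm

theorem complexOrderDeriv_sin (p : ℂ) {z : ℂ} (hz : z ≠ 0) :
    complexOrderDeriv p Complex.sin z = cosSeries (p - 1) z :=
  (hasSum_complexOrderDeriv_sin p hz).tsum_eq.symm

/-! ### Dependence on `x`: termwise derivative and limit at `0+`. -/

theorem norm_cosTerm_ofReal (p : ℂ) {x : ℝ} (hx : 0 < x) (m : ℕ) :
    ‖cosTerm p x m‖ = x ^ (2 * (m : ℝ) - p.re) / ‖Complex.Gamma (2 * (m : ℂ) + 1 - p)‖ := by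
  simp [cosTerm, Complex.norm_cpow_eq_rpow_re_of_pos hx]

theorem norm_cosTerm_le_of_le {p : ℂ} (hp : p.re ≤ 0) {x y : ℝ} (hx : 0 < x) (hxy : x ≤ y)
    (m : ℕ) : ‖cosTerm p x m‖ ≤ ‖cosTerm p y m‖ := by
  rw [norm_cosTerm_ofReal p hx, norm_cosTerm_ofReal p (hx.trans_le hxy)]
  have : (0 : ℝ) ≤ 2 * (m : ℝ) - p.re := by
    have : (0 : ℝ) ≤ m := m.cast_nonneg
    linarith
  gcongr

theorem hasDerivAt_cosTerm (p : ℂ) {x : ℝ} (hx : 0 < x) (m : ℕ) :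
    HasDerivAt (fun y : ℝ => cosTerm p y m) (cosTerm (p + 1) x m) x := by
  have h := (((hasDerivAt_id (x : ℂ)).cpow_const (c := 2 * (m : ℂ) - p)
    (Complex.ofReal_mem_slitPlane.2 hx)).comp_ofReal.const_mul ((-1 : ℂ) ^ m)).div_const
    (Complex.Gamma (2 * (m : ℂ) + 1 - p))
  have h1 := Complex.one_div_Gamma_eq_self_mul_one_div_Gamma_add_one (2 * (m : ℂ) + 1 - (p + 1))
  refine h.congr_deriv ?_
  rw [cosTerm, div_eq_mul_inv, div_eq_mul_inv, h1]
  simp only [id]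
  rw [show 2 * (m : ℂ) + 1 - (p + 1) + 1 = 2 * (m : ℂ) + 1 - p by ring,
    show 2 * (m : ℂ) - (p + 1) = 2 * (m : ℂ) - p - 1 by ring]
  ring

/-- For `Re (p + 1) ≤ 0` the differentiated terms increase in norm with `x`, so their values at `x +
1` dominate on `(0, x + 1)`. -/
theorem hasDerivAt_cosSeries {p : ℂ} (hp : p.re ≤ -1) {x : ℝ} (hx : 0 < x) :
    HasDerivAt (fun y : ℝ => cosSeries p y) (cosSeries (p + 1) x) x := by
  have h1 : ((x + 1 : ℝ) : ℂ) ≠ 0 := by exact_mod_cast (by positivity : x + 1 ≠ 0)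
  refine hasDerivAt_tsum_of_isPreconnected (t := Set.Ioo 0 (x + 1)) (y₀ := x)
    (summable_cosTerm (p + 1) h1).norm isOpen_Ioo isPreconnected_Ioo
    (fun m y hy => hasDerivAt_cosTerm p hy.1 m)
    (fun m y hy => norm_cosTerm_le_of_le (by simp; linarith) hy.1 hy.2.le m)
    ⟨hx, by linarith⟩ (summable_cosTerm p (by exact_mod_cast hx.ne')) ⟨hx, by linarith⟩

/-- Here the first term may be unbounded at 0. It is split off, leaving a series of order `p - 1`
covered by `hasDerivAt_cosSeries`. -/
theorem hasDerivAt_cosSeries_add_one {p : ℂ} (hp : p.re ≤ 0) {x : ℝ} (hx : 0 < x) :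
    HasDerivAt (fun y : ℝ => cosSeries (p + 1) y)
      ((x : ℂ) ^ (-p - 2) / Complex.Gamma (-p - 1) - cosSeries p x) x := by
  have h := ((hasDerivAt_id (x : ℂ)).cpow_const (c := -(p + 1))
    (Complex.ofReal_mem_slitPlane.2 hx)).comp_ofReal.div_const (Complex.Gamma (1 - (p + 1)))
  have h' := h.sub (hasDerivAt_cosSeries (p := p - 1) (by simp; linarith) hx)
  have h1 := Complex.one_div_Gamma_eq_self_mul_one_div_Gamma_add_one (-p - 1)
  refine (h'.congr_of_eventuallyEq ?_).congr_deriv ?_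
  · filter_upwards [eventually_gt_nhds hx] with y hy
    rw [cosSeries_eq_sub _ (by exact_mod_cast hy.ne')]
    simp [show p + 1 - 2 = p - 1 by ring]
  · rw [div_eq_mul_inv _ (Complex.Gamma (-p - 1)), h1, sub_add_cancel]
    simp only [id]
    rw [show 1 - (p + 1) = -p by ring, show -p - 1 + 1 = -p by ring,
      show -(p + 1) - 1 = -p - 2 by ring]
    ring

theorem tendsto_cosSeries_zero {p : ℂ} (hp : p.re < 0) :
    Tendsto (fun x : ℝ => cosSeries p x) (𝓝[>] 0) (𝓝 0) := by
  have hs : Summable (fun m => ‖cosTerm p ((1 : ℝ) : ℂ) m‖) :=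
    (summable_cosTerm p (by simp)).norm
  have h0 : ∑' m : ℕ, (0 : ℂ) = 0 := tsum_zero
  rw [← h0]
  refine tendsto_tsum_of_dominated_convergence hs (fun m => ?_) ?_
  · rw [tendsto_zero_iff_norm_tendsto_zero]
    have he : 0 < 2 * (m : ℝ) - p.re := by
      have : (0 : ℝ) ≤ m := m.cast_nonneg
      linarith
    have : Tendsto (fun x : ℝ => x ^ (2 * (m : ℝ) - p.re) /
        ‖Complex.Gamma (2 * (m : ℂ) + 1 - p)‖) (𝓝[>] 0) (𝓝 0) := by
      have := ((Real.continuousAt_rpow_const 0 _ (Or.inr he.le)).tendsto.mono_left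
        (nhdsWithin_le_nhds (s := Set.Ioi 0))).div_const ‖Complex.Gamma (2 * (m : ℂ) + 1 - p)‖
      simpa [Real.zero_rpow he.ne'] using this
    refine this.congr' ?_
    filter_upwards [self_mem_nhdsWithin] with x hx
    rw [norm_cosTerm_ofReal p hx]
  · filter_upwards [Ioo_mem_nhdsGT one_pos] with x hx m
    exact norm_cosTerm_le_of_le hp.le hx.1 hx.2.le m

/-! ### Holomorphy in the order. -/

theorem norm_inv_Gamma_add_nat_le {s : ℂ} (hs : 1 ≤ s.re) (n : ℕ) :
    ‖(Complex.Gamma (s + n))⁻¹‖ ≤ ‖(Complex.Gamma s)⁻¹‖ / n.factorial := by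
  induction n with
  | zero => simp
  | succ n ih =>
    have h1 := Complex.one_div_Gamma_eq_self_mul_one_div_Gamma_add_one (s + n)
    have h2 : ((n : ℝ) + 1) ≤ ‖s + n‖ := by
      have := Complex.re_le_norm (s + n)
      simp at this
      linarith
    rw [h1, norm_mul] at ih
    rw [Nat.factorial_succ, Nat.cast_mul, Nat.cast_succ, Nat.cast_succ, ← add_assoc,
      le_div_iff₀ (by positivity)]
    rw [le_div_iff₀ (by positivity)] at ih
    refine le_trans (le_of_eq ?_) ((mul_le_mul_of_nonneg_right (mul_le_mul_of_nonneg_right h2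
      (norm_nonneg _)) (by positivity)).trans ih)
    ring

theorem differentiableAt_cosSeries_order_of_re_neg {x : ℝ} (hx : 0 < x) {p : ℂ} (hp : p.re < 0) :
    DifferentiableAt ℂ (fun q : ℂ => cosSeries q x) p := by
  have hx0 : (x : ℂ) ≠ 0 := by exact_mod_cast hx.ne'
  have hΓ : Differentiable ℂ fun s : ℂ => (Complex.Gamma s)⁻¹ :=
    Complex.differentiable_one_div_Gamma
  have hc : ContinuousAt (fun q : ℂ => ‖(Complex.Gamma (1 - q))⁻¹‖ * ‖(x : ℂ) ^ (-q)‖) p := by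
    refine ContinuousAt.mul ?_ ?_
    · exact (hΓ.continuous.comp (continuous_const.sub continuous_id)).norm.continuousAt
    · exact (continuousAt_const_cpow hx0).norm.comp continuousAt_id.neg
  obtain ⟨U, hU, hUo, hpU⟩ := eventually_nhds_iff.1
    ((hc.eventually (gt_mem_nhds (lt_add_one _))).and
      (Complex.continuous_re.continuousAt.eventually (gt_mem_nhds hp)))
  set M : ℝ := ‖(Complex.Gamma (1 - p))⁻¹‖ * ‖(x : ℂ) ^ (-p)‖ + 1
  have hsum : Summable (fun m : ℕ => M * (x ^ (2 * m) / (2 * m).factorial)) :=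
    ((Real.summable_pow_div_factorial x).comp_injective
      (i := fun m : ℕ => 2 * m) (fun a b h => by simpa using h)).mul_left M
  refine (Complex.differentiableOn_tsum_of_summable_norm (F := fun m q => cosTerm q x m) hsum
    (fun m => ?_) hUo (fun m q hq => ?_)).differentiableAt (hUo.mem_nhds hpU)
  · refine Differentiable.differentiableOn ?_
    simp only [cosTerm, div_eq_mul_inv]
    refine Differentiable.mul (Differentiable.const_mul ?_ _) ?_
    · exact fun q => ((differentiableAt_const _).sub differentiableAt_id).const_cpow (Or.inl hx0)
    · exact hΓ.comp ((differentiable_const _).sub differentiable_id)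
  · obtain ⟨h1, h2⟩ := hU q hq
    have h3 := norm_inv_Gamma_add_nat_le (s := 1 - q) (by simp; linarith) (2 * m)
    have e : 2 * (m : ℂ) - q = -q + ((2 * m : ℕ) : ℂ) := by push_cast; ring
    have e' : 2 * (m : ℂ) + 1 - q = 1 - q + ((2 * m : ℕ) : ℂ) := by push_cast; ring
    rw [cosTerm, e, e', Complex.cpow_add _ _ hx0, Complex.cpow_natCast, div_eq_mul_inv]
    simp only [norm_mul, norm_pow, norm_neg, norm_one, one_pow, one_mul, Complex.norm_real,
      Real.norm_of_nonneg hx.le]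
    calc ‖(x : ℂ) ^ (-q)‖ * x ^ (2 * m) * ‖(Complex.Gamma (1 - q + ((2 * m : ℕ) : ℂ)))⁻¹‖
        ≤ ‖(x : ℂ) ^ (-q)‖ * x ^ (2 * m) *
          (‖(Complex.Gamma (1 - q))⁻¹‖ / (2 * m).factorial) := by gcongr
      _ = (‖(Complex.Gamma (1 - q))⁻¹‖ * ‖(x : ℂ) ^ (-q)‖) *
          (x ^ (2 * m) / (2 * m).factorial) := by ring
      _ ≤ _ := by gcongr

/-- `cosSeries_eq_sub` carries holomorphy from `Re p < 2n` to `Re p < 2(n + 1)`, as `1/Γ` is entire.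
-/
theorem differentiable_cosSeries_order {x : ℝ} (hx : 0 < x) :
    Differentiable ℂ (fun q : ℂ => cosSeries q x) := by
  have hx0 : (x : ℂ) ≠ 0 := by exact_mod_cast hx.ne'
  have key : ∀ n : ℕ, ∀ p : ℂ, p.re < 2 * n →
      DifferentiableAt ℂ (fun q : ℂ => cosSeries q x) p := by
    intro n
    induction n with
    | zero => exact fun p hp => differentiableAt_cosSeries_order_of_re_neg hx (by simpa using hp)
    | succ n ih =>
      intro p hp
      rw [show (fun q : ℂ => cosSeries q x) = fun q => (x : ℂ) ^ (-q) * (Complex.Gamma (1 - q))⁻¹ -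
        cosSeries (q - 2) x from funext fun q => cosSeries_eq_sub q hx0]
      refine DifferentiableAt.sub (DifferentiableAt.mul ?_ ?_) ?_
      · exact differentiableAt_id.neg.const_cpow (Or.inl hx0)
      · exact (Complex.differentiable_one_div_Gamma.comp
          ((differentiable_const (1 : ℂ)).sub differentiable_id)).differentiableAt
      · exact (ih (p - 2) (by simp at hp ⊢; linarith)).comp p
          (differentiableAt_id.sub (differentiableAt_const _))
  intro p
  obtain ⟨n, hn⟩ := exists_nat_gt p.re
  exact key n p (by have : (0 : ℝ) ≤ n := n.cast_nonneg
                    linarith)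

/-! ### Mellin transform of `1/(1+t²)`. -/

open MeasureTheory Set in
theorem integrableOn_cpow_mul_exp_neg {s : ℂ} (hs : 0 < s.re) {r : ℝ} (hr : 0 < r) :
    IntegrableOn (fun t : ℝ => (t : ℂ) ^ (s - 1) * Complex.exp (-(r * t))) (Ioi 0) := by
  have h := integrableOn_rpow_mul_exp_neg_mul_rpow (s := s.re - 1) (p := 1) (b := r)
    (by linarith) one_pos hr
  refine Integrable.mono' h ?_ ?_
  · exact Measurable.aestronglyMeasurable (by fun_prop)
  · filter_upwards [ae_restrict_mem measurableSet_Ioi] with t ht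
    simp [Complex.norm_cpow_eq_rpow_re_of_pos ht, Complex.norm_exp]

open MeasureTheory Set in
theorem integrableOn_rpow_mul_exp_neg {σ : ℝ} (hσ : 0 < σ) {r : ℝ} (hr : 0 < r) :
    IntegrableOn (fun t : ℝ => t ^ (σ - 1) * Real.exp (-(r * t))) (Ioi 0) := by
  simpa using integrableOn_rpow_mul_exp_neg_mul_rpow (s := σ - 1) (p := 1) (b := r)
    (by linarith) one_pos hr

open MeasureTheory Set in
theorem integrable_mellin_exp_kernel {s : ℂ} (h0 : 0 < s.re) (h1 : s.re < 1) :
    Integrable (Function.uncurry fun t u : ℝ =>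
      (t : ℂ) ^ (s - 1) * (Complex.exp (-(u * t)) * Complex.exp (-u)))
      ((volume.restrict (Ioi 0)).prod (volume.restrict (Ioi 0))) := by
  rw [integrable_prod_iff']
  · constructor
    · filter_upwards [ae_restrict_mem measurableSet_Ioi] with u hu
      simp only [Function.uncurry, ← mul_assoc]
      exact (integrableOn_cpow_mul_exp_neg h0 hu).mul_const _
    · have h := ((Real.GammaIntegral_convergent (s := 1 - s.re) (by linarith)).mul_const
        (Real.Gamma s.re))
      refine Integrable.congr h ?_
      filter_upwards [ae_restrict_mem measurableSet_Ioi] with u hu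
      have hu' : 0 < u := hu
      have : ∫ t in Ioi (0 : ℝ), ‖(t : ℂ) ^ (s - 1) * (Complex.exp (-(u * t)) * Complex.exp (-u))‖
          = ∫ t in Ioi (0 : ℝ), t ^ (s.re - 1) * Real.exp (-(u * t)) * Real.exp (-u) := by
        refine setIntegral_congr_fun measurableSet_Ioi fun t ht => ?_
        simp [Complex.norm_cpow_eq_rpow_re_of_pos ht, Complex.norm_exp, mul_assoc]
      simp only [Function.uncurry]
      rw [this, integral_mul_const, Real.integral_rpow_mul_exp_neg_mul_Ioi h0 hu', one_div,
        Real.inv_rpow hu'.le, ← Real.rpow_neg hu'.le, show 1 - s.re - 1 = -s.re by ring]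
      ring
  · exact Measurable.aestronglyMeasurable (by fun_prop)

-- Writing `1/(1+t) = ∫₀^∞ e^(-ut) e^(-u) du` and swapping the integrals gives `Γ(s) Γ(1-s)`.
open MeasureTheory Set in
theorem hasMellin_inv_one_add {s : ℂ} (h0 : 0 < s.re) (h1 : s.re < 1) :
    HasMellin (fun t : ℝ => (1 + (t : ℂ))⁻¹) s (Real.pi / Complex.sin (Real.pi * s)) := by
  have hint := integrable_mellin_exp_kernel h0 h1
  have hinner : ∀ t ∈ Ioi (0 : ℝ), ∫ u in Ioi (0 : ℝ),
      (t : ℂ) ^ (s - 1) * (Complex.exp (-(u * t)) * Complex.exp (-u)) =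
      (t : ℂ) ^ (s - 1) • (1 + (t : ℂ))⁻¹ := by
    intro t ht
    have ht' : 0 < 1 + t := by linarith [mem_Ioi.1 ht]
    have h := Complex.integral_cpow_mul_exp_neg_mul_Ioi (a := 1) (by simp) ht'
    rw [integral_const_mul, smul_eq_mul]
    congr 1
    simp only [sub_self, Complex.cpow_zero, one_mul, Complex.cpow_one, Complex.Gamma_one, mul_one]
      at h
    push_cast at h
    rw [← one_div, ← h]
    refine setIntegral_congr_fun measurableSet_Ioi fun u _ => ?_
    simp only [← Complex.exp_add]
    congr 1
    ring
  constructor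
  · refine Integrable.congr hint.integral_prod_left ?_
    filter_upwards [ae_restrict_mem measurableSet_Ioi] with t ht
    exact hinner t ht
  · rw [mellin, ← setIntegral_congr_fun measurableSet_Ioi hinner, integral_integral_swap hint,
      ← Complex.Gamma_mul_Gamma_one_sub, Complex.Gamma_eq_integral (s := 1 - s) (by simpa using h1),
      Complex.GammaIntegral, ← integral_const_mul]
    refine setIntegral_congr_fun measurableSet_Ioi fun u hu => ?_
    have hu' : (u : ℂ) ≠ 0 := by exact_mod_cast (mem_Ioi.1 hu).ne'
    simp only [← mul_assoc]
    rw [integral_mul_const, Complex.integral_cpow_mul_exp_neg_mul_Ioi h0 hu, one_div,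
      Complex.inv_cpow _ _ (by rw [Complex.arg_ofReal_of_nonneg (mem_Ioi.1 hu).le]
                               exact Real.pi_pos.ne),
      show 1 - s - 1 = -s by ring, Complex.cpow_neg]
    push_cast
    ring

theorem hasMellin_inv_one_add_sq {s : ℂ} (h0 : 0 < s.re) (h2 : s.re < 2) :
    HasMellin (fun t : ℝ => (1 + (t : ℂ) ^ 2)⁻¹) s
      (Real.pi / (2 * Complex.sin (Real.pi * s / 2))) := by
  have hre : (s / 2).re = s.re / 2 := by simp
  obtain ⟨hc, hv⟩ := hasMellin_inv_one_add (s := s / 2) (by rw [hre]; linarith)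
    (by rw [hre]; linarith)
  have hf : (fun t : ℝ => (1 + (t : ℂ) ^ 2)⁻¹) =
      fun t : ℝ => (fun u : ℝ => (1 + (u : ℂ))⁻¹) (t ^ (2 : ℝ)) := by
    funext t
    simp
  rw [hf]
  constructor
  · refine (MellinConvergent.comp_rpow (f := fun u : ℝ => (1 + (u : ℂ))⁻¹) two_ne_zero).2 ?_
    exact_mod_cast hc
  · rw [mellin_comp_rpow (fun u : ℝ => (1 + (u : ℂ))⁻¹), show s / ((2 : ℝ) : ℂ) = s / 2 by norm_num, hv, mul_div_assoc]
    rw [abs_of_pos two_pos, Complex.real_smul]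
    push_cast
    rw [← div_div, mul_comm, ← div_eq_mul_inv, div_right_comm]

/-! ### The exponentially damped Mellin integral. -/

/-- The Mellin transform of `t ↦ exp (-x t) / (1 + t ^ 2)`. -/
noncomputable def expMellin (s : ℂ) (x : ℝ) : ℂ :=
  mellin (fun t : ℝ => Complex.exp (-(x * t)) * (1 + (t : ℂ) ^ 2)⁻¹) s

theorem one_add_ofReal_sq_ne_zero (t : ℝ) : 1 + (t : ℂ) ^ 2 ≠ 0 := by
  have : (1 + t ^ 2 : ℝ) ≠ 0 := by positivity
  exact_mod_cast this

theorem norm_inv_one_add_ofReal_sq_le (t : ℝ) : ‖(1 + (t : ℂ) ^ 2)⁻¹‖ ≤ 1 := by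
  have h : (1 + (t : ℂ) ^ 2)⁻¹ = (((1 + t ^ 2)⁻¹ : ℝ) : ℂ) := by push_cast; rfl
  rw [h, Complex.norm_real, Real.norm_of_nonneg (by positivity)]
  exact inv_le_one_of_one_le₀ (by nlinarith [sq_nonneg t])

theorem norm_cpow_smul_exp_le {s : ℂ} {x t : ℝ} (ht : 0 < t) :
    ‖(t : ℂ) ^ (s - 1) • (Complex.exp (-(x * t)) * (1 + (t : ℂ) ^ 2)⁻¹)‖ ≤
      t ^ (s.re - 1) * Real.exp (-(x * t)) := by
  have h : ‖Complex.exp (-(x * t))‖ = Real.exp (-(x * t)) := by simp [Complex.norm_exp]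
  rw [norm_smul, norm_mul, h, Complex.norm_cpow_eq_rpow_re_of_pos ht]
  simp only [Complex.sub_re, Complex.one_re]
  gcongr
  exact mul_le_of_le_one_right (Real.exp_pos _).le (norm_inv_one_add_ofReal_sq_le t)

open MeasureTheory Set in
theorem mellinConvergent_exp {s : ℂ} (hs : 0 < s.re) {x : ℝ} (hx : 0 < x) :
    MellinConvergent (fun t : ℝ => Complex.exp (-(x * t)) * (1 + (t : ℂ) ^ 2)⁻¹) s := by
  refine Integrable.mono' (integrableOn_rpow_mul_exp_neg hs hx) ?_ ?_
  · exact Measurable.aestronglyMeasurable (by fun_prop)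
  · filter_upwards [ae_restrict_mem measurableSet_Ioi] with t ht
    exact norm_cpow_smul_exp_le ht

open MeasureTheory Set in
theorem hasDerivAt_expMellin {s : ℂ} (hs : 0 < s.re) {x : ℝ} (hx : 0 < x) :
    HasDerivAt (expMellin s) (-expMellin (s + 1) x) x := by
  have hbound := integrableOn_rpow_mul_exp_neg (σ := s.re + 1) (by linarith)
    (r := x / 2) (by linarith)
  have key := hasDerivAt_integral_of_dominated_loc_of_deriv_le (μ := volume.restrict (Ioi 0))
    (F := fun y t : ℝ => (t : ℂ) ^ (s - 1) • (Complex.exp (-(y * t)) * (1 + (t : ℂ) ^ 2)⁻¹))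
    (F' := fun y t : ℝ =>
      -((t : ℂ) ^ (s + 1 - 1) • (Complex.exp (-(y * t)) * (1 + (t : ℂ) ^ 2)⁻¹)))
    -- Staying above `x / 2` gives the integrable majorant `t^(Re s) e^(-xt/2)`.
    (s := Ioi (x / 2)) (x₀ := x) (Ioi_mem_nhds (by linarith))
    (Eventually.of_forall fun y => Measurable.aestronglyMeasurable (by fun_prop))
    (mellinConvergent_exp hs hx) (Measurable.aestronglyMeasurable (by fun_prop)) ?_ hbound ?_
  · have h := key.2
    rw [integral_neg] at h
    exact h
  · filter_upwards [ae_restrict_mem measurableSet_Ioi] with t ht y hy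
    have ht' : 0 < t := ht
    rw [norm_neg]
    refine (norm_cpow_smul_exp_le ht').trans ?_
    simp only [Complex.add_re, Complex.one_re]
    have : x / 2 ≤ y := le_of_lt hy
    gcongr
  · filter_upwards [ae_restrict_mem measurableSet_Ioi] with t ht y hy
    have ht' : (t : ℂ) ≠ 0 := by exact_mod_cast (mem_Ioi.1 ht).ne'
    have h1 : HasDerivAt (fun y : ℝ => -((y : ℂ) * t)) (-((1 : ℂ) * t)) y :=
      (Complex.ofRealCLM.hasDerivAt.mul_const (t : ℂ)).neg
    have h2 := ((h1.cexp).mul_const (1 + (t : ℂ) ^ 2)⁻¹).const_mul ((t : ℂ) ^ (s - 1))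
    refine h2.congr_deriv ?_
    rw [show s + 1 - 1 = (s - 1) + 1 by ring, Complex.cpow_add _ _ ht', Complex.cpow_one,
      smul_eq_mul]
    ring

-- Since `t²/(1+t²) = 1 - 1/(1+t²)`, the sum of the two integrals is a Gamma integral. As the second
-- derivative shifts `s` by 2, this is a forced oscillator equation in `x`.
open MeasureTheory Set in
theorem expMellin_add_two {s : ℂ} (hs : 0 < s.re) {x : ℝ} (hx : 0 < x) :
    expMellin (s + 2) x = (x : ℂ) ^ (-s) * Complex.Gamma s - expMellin s x := by
  have hxs : (x : ℂ) ^ (-s) * Complex.Gamma s = (1 / x) ^ s * Complex.Gamma s := by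
    rw [one_div, Complex.inv_cpow _ _ (by rw [Complex.arg_ofReal_of_nonneg hx.le]
                                          exact Real.pi_pos.ne), Complex.cpow_neg]
  rw [hxs, eq_sub_iff_add_eq, ← Complex.integral_cpow_mul_exp_neg_mul_Ioi hs hx, expMellin,
    expMellin, mellin, mellin, ← integral_add]
  · refine setIntegral_congr_fun measurableSet_Ioi fun t ht => ?_
    have ht' : (t : ℂ) ≠ 0 := by exact_mod_cast (mem_Ioi.1 ht).ne'
    have h2 := one_add_ofReal_sq_ne_zero t
    simp only [smul_eq_mul]
    rw [show s + 2 - 1 = (s - 1) + (2 : ℕ) by push_cast; ring, Complex.cpow_add _ _ ht',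
      Complex.cpow_natCast]
    field_simp
    ring
  · exact mellinConvergent_exp (by simp; linarith) hx
  · exact mellinConvergent_exp hs hx

open MeasureTheory Set in
theorem tendsto_expMellin_zero {s : ℂ} (h0 : 0 < s.re) (h2 : s.re < 2) :
    Tendsto (expMellin s) (𝓝[>] 0) (𝓝 (Real.pi / (2 * Complex.sin (Real.pi * s / 2)))) := by
  obtain ⟨hc, hv⟩ := hasMellin_inv_one_add_sq h0 h2
  rw [← hv]
  refine tendsto_integral_filter_of_dominated_convergence _
    (Eventually.of_forall fun y => Measurable.aestronglyMeasurable (by fun_prop)) ?_ hc.norm ?_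
  · filter_upwards [self_mem_nhdsWithin] with x hx
    filter_upwards [ae_restrict_mem measurableSet_Ioi] with t ht
    have hx' : 0 < x := hx
    have ht' : 0 < t := ht
    rw [norm_smul, norm_smul, norm_mul]
    refine mul_le_mul_of_nonneg_left (mul_le_of_le_one_left (norm_nonneg _) ?_) (norm_nonneg _)
    rw [Complex.norm_exp]
    simp
    positivity
  · refine Eventually.of_forall fun t => ?_
    have hcont : Continuous fun x : ℝ =>
        (t : ℂ) ^ (s - 1) • (Complex.exp (-(x * t)) * (1 + (t : ℂ) ^ 2)⁻¹) := by fun_prop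
    simpa using (hcont.tendsto 0).mono_left nhdsWithin_le_nhds

open MeasureTheory Set in
theorem tendsto_expMellin_atTop {s : ℂ} (hs : 0 < s.re) :
    Tendsto (expMellin s) atTop (𝓝 0) := by
  have hlim : Tendsto (fun x : ℝ => x ^ (-s.re) * Real.Gamma s.re) atTop (𝓝 0) := by
    simpa using (tendsto_rpow_neg_atTop hs).mul_const (Real.Gamma s.re)
  refine squeeze_zero_norm' ?_ hlim
  filter_upwards [eventually_gt_atTop 0] with x hx
  have h := norm_integral_le_of_norm_le (integrableOn_rpow_mul_exp_neg hs hx)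
    (f := fun t : ℝ => (t : ℂ) ^ (s - 1) • (Complex.exp (-(x * t)) * (1 + (t : ℂ) ^ 2)⁻¹)) (by
      filter_upwards [ae_restrict_mem measurableSet_Ioi] with t ht
      exact norm_cpow_smul_exp_le ht)
  rwa [Real.integral_rpow_mul_exp_neg_mul_Ioi hs hx, one_div, Real.inv_rpow hx.le,
    ← Real.rpow_neg hx.le] at h

open Asymptotics in
theorem differentiableAt_expMellin {s : ℂ} (hs : 0 < s.re) {x : ℝ} (hx : 0 < x) :
    DifferentiableAt ℂ (fun w => expMellin w x) s := by
  have hcont : Continuous fun t : ℝ => Complex.exp (-(x * t)) * (1 + (t : ℂ) ^ 2)⁻¹ := by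
    refine Continuous.mul (by fun_prop) (Continuous.inv₀ (by fun_prop) one_add_ofReal_sq_ne_zero)
  refine mellin_differentiableAt_of_isBigO_rpow_exp (a := x) (b := 0) hx
    (hcont.locallyIntegrable.locallyIntegrableOn _) ?_ ?_ hs
  · refine IsBigO.of_bound 1 (Eventually.of_forall fun t => ?_)
    rw [norm_mul, one_mul]
    refine (mul_le_of_le_one_right (norm_nonneg _) (norm_inv_one_add_ofReal_sq_le t)).trans ?_
    simp [Complex.norm_exp]
  · simp only [neg_zero, Real.rpow_zero]
    exact hcont.continuousAt.isBigO_one ℝ |>.mono nhdsWithin_le_nhds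

/-! ### The integral representation. -/

/-- The combinations `h cos - k sin` and `h sin + k cos` are constant, hence equal to their limit 0
at `0+`; `h` is recovered from them by `sin² + cos² = 1`. -/
theorem eq_zero_of_harmonic_oscillator {h k : ℝ → ℂ}
    (hh : ∀ x, 0 < x → HasDerivAt h (k x) x) (hk : ∀ x, 0 < x → HasDerivAt k (-h x) x)
    (h0 : Tendsto h (𝓝[>] 0) (𝓝 0)) (k0 : Tendsto k (𝓝[>] 0) (𝓝 0)) {x : ℝ} (hx : 0 < x) :
    h x = 0 := by
  have hcos (y : ℝ) : HasDerivAt (fun y : ℝ => Complex.cos y) (-Complex.sin y) y :=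
    (Complex.hasDerivAt_cos y).comp_ofReal
  have hsin (y : ℝ) : HasDerivAt (fun y : ℝ => Complex.sin y) (Complex.cos y) y :=
    (Complex.hasDerivAt_sin y).comp_ofReal
  have key : ∀ f : ℝ → ℂ, (∀ y, 0 < y → HasDerivAt f 0 y) → Tendsto f (𝓝[>] 0) (𝓝 0) →
      f x = 0 := by
    intro f hf f0
    have hconst : ∀ y, 0 < y → f y = f x := fun y hy =>
      isOpen_Ioi.is_const_of_deriv_eq_zero isPreconnected_Ioi
        (fun z hz => (hf z hz).differentiableAt.differentiableWithinAt)
        (fun z hz => (hf z hz).deriv) hy hx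
    refine tendsto_nhds_unique (tendsto_const_nhds.congr' ?_) f0
    filter_upwards [self_mem_nhdsWithin] with y hy
    exact (hconst y hy).symm
  have lim (f : ℂ → ℂ) (hf : Continuous f) :
      Tendsto (fun y : ℝ => f y) (𝓝[>] 0) (𝓝 (f (0 : ℝ))) :=
    ((hf.comp Complex.continuous_ofReal).tendsto 0).mono_left nhdsWithin_le_nhds
  have e1 := key (fun y => h y * Complex.cos y - k y * Complex.sin y)
    (fun y hy => (((hh y hy).mul (hcos y)).sub ((hk y hy).mul (hsin y))).congr_deriv (by ring))
    (by simpa using (h0.mul (lim _ Complex.continuous_cos)).sub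
          (k0.mul (lim _ Complex.continuous_sin)))
  have e2 := key (fun y => h y * Complex.sin y + k y * Complex.cos y)
    (fun y hy => (((hh y hy).mul (hsin y)).add ((hk y hy).mul (hcos y))).congr_deriv (by ring))
    (by simpa using (h0.mul (lim _ Complex.continuous_sin)).add
          (k0.mul (lim _ Complex.continuous_cos)))
  linear_combination Complex.cos x * e1 + Complex.sin x * e2 -
    h x * Complex.sin_sq_add_cos_sq (x : ℂ)

theorem sin_pi_mul_ne_zero_of_re_mem_Ioo {p : ℂ} (h1 : -2 < p.re) (h2 : p.re < -1) :
    Complex.sin (Real.pi * p) ≠ 0 := by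
  rw [Ne, Complex.sin_eq_zero_iff]
  rintro ⟨k, hk⟩
  have hpi : (Real.pi : ℂ) ≠ 0 := by exact_mod_cast Real.pi_ne_zero
  have hp : p = k := mul_left_cancel₀ hpi (by rw [hk, mul_comm])
  rw [hp, Complex.intCast_re] at h1 h2
  have h1' : (-2 : ℤ) < k := by exact_mod_cast h1
  have h2' : k < (-1 : ℤ) := by exact_mod_cast h2
  omega

/-- The strip is where everything has a limit at `0+`: `Re p < -1` makes `cosSeries (p + 1)` vanish
there and the undamped Mellin integral at `p + 3` converge, while `-2 < Re p` serves the one at `p +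
2`. -/
theorem cosSeries_eq_cos_add_expMellin_of_strip {p : ℂ} (h1 : -2 < p.re) (h2 : p.re < -1)
    {x : ℝ} (hx : 0 < x) :
    cosSeries p x = Complex.cos (x + p * Real.pi / 2) +
      Complex.sin (Real.pi * p) / Real.pi * expMellin (p + 2) x := by
  have hpi : (Real.pi : ℂ) ≠ 0 := by exact_mod_cast Real.pi_ne_zero
  have hs := sin_pi_mul_ne_zero_of_re_mem_Ioo h1 h2
  set K : ℂ := Complex.sin (Real.pi * p) / Real.pi with hK
  set φ : ℂ := p * Real.pi / 2 with hφ
  have hsin2 : Complex.sin (Real.pi * p) = 2 * Complex.sin φ * Complex.cos φ := by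
    rw [← Complex.sin_two_mul, hφ]; congr 1; ring
  have hsφ : Complex.sin φ ≠ 0 := fun h => hs (by rw [hsin2, h]; ring)
  have hcφ : Complex.cos φ ≠ 0 := fun h => hs (by rw [hsin2, h]; ring)
  -- This makes the forcing terms of the series and of the integral cancel in `k' = -h`.
  have hΓ : (Complex.Gamma (-p - 1))⁻¹ = K * Complex.Gamma (p + 2) := by
    have h := Complex.Gamma_mul_Gamma_one_sub (p + 2)
    rw [show 1 - (p + 2) = -p - 1 by ring,
      show (Real.pi : ℂ) * (p + 2) = Real.pi * p + 2 * Real.pi by ring,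
      Complex.sin_add_two_pi] at h
    have hne : Complex.Gamma (-p - 1) ≠ 0 := by
      intro h0
      rw [h0, mul_zero] at h
      exact div_ne_zero hpi hs h.symm
    rw [inv_eq_iff_eq_inv, eq_comm, inv_eq_iff_eq_inv, eq_comm, eq_comm]
    field_simp
    rw [eq_div_iff hs] at h
    rw [hK]
    field_simp
    linear_combination h
  have key := eq_zero_of_harmonic_oscillator
    (h := fun y : ℝ => cosSeries p y - Complex.cos (y + φ) - K * expMellin (p + 2) y)
    (k := fun y : ℝ => cosSeries (p + 1) y + Complex.sin (y + φ) + K * expMellin (p + 3) y)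
    (fun y hy => ?_) (fun y hy => ?_) ?_ ?_ hx
  · linear_combination key
  · have d1 := hasDerivAt_cosSeries h2.le hy
    have d2 : HasDerivAt (fun y : ℝ => Complex.cos (y + φ)) (-Complex.sin (y + φ) * 1) y :=
      (((hasDerivAt_id (y : ℂ)).add_const φ).ccos).comp_ofReal
    have d3 := (hasDerivAt_expMellin (s := p + 2) (by simp; linarith) hy).const_mul K
    refine ((d1.sub d2).sub d3).congr_deriv ?_
    rw [show p + 2 + 1 = p + 3 by ring]
    ring
  · have d1 := hasDerivAt_cosSeries_add_one (p := p) (by linarith) hy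
    have d2 : HasDerivAt (fun y : ℝ => Complex.sin (y + φ)) (Complex.cos (y + φ) * 1) y :=
      (((hasDerivAt_id (y : ℂ)).add_const φ).csin).comp_ofReal
    have d3 := (hasDerivAt_expMellin (s := p + 3) (by simp; linarith) hy).const_mul K
    refine ((d1.add d2).add d3).congr_deriv ?_
    rw [show p + 3 + 1 = p + 2 + 2 by ring, expMellin_add_two (by simp; linarith) hy,
      div_eq_mul_inv, hΓ, show -(p + 2) = -p - 2 by ring]
    ring
  · have t1 := tendsto_cosSeries_zero (p := p) (by linarith)
    have t2 : Tendsto (fun y : ℝ => Complex.cos (y + φ)) (𝓝[>] 0) (𝓝 (Complex.cos φ)) := by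
      have : Continuous fun y : ℝ => Complex.cos (y + φ) := by fun_prop
      simpa using (this.tendsto 0).mono_left nhdsWithin_le_nhds
    have t3 := (tendsto_expMellin_zero (s := p + 2) (by simp; linarith)
      (by simp; linarith)).const_mul K
    convert (t1.sub t2).sub t3 using 2
    -- The integral contributes `-cos φ` in the limit, by `sin (πp) = 2 sin φ cos φ`.
    rw [show (Real.pi : ℂ) * (p + 2) / 2 = φ + Real.pi by rw [hφ]; ring, Complex.sin_add_pi, hK,
      hsin2]
    field_simp
    ring
  · have t1 := tendsto_cosSeries_zero (p := p + 1) (by simp; linarith)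
    have t2 : Tendsto (fun y : ℝ => Complex.sin (y + φ)) (𝓝[>] 0) (𝓝 (Complex.sin φ)) := by
      have : Continuous fun y : ℝ => Complex.sin (y + φ) := by fun_prop
      simpa using (this.tendsto 0).mono_left nhdsWithin_le_nhds
    have t3 := (tendsto_expMellin_zero (s := p + 3) (by simp; linarith)
      (by simp; linarith)).const_mul K
    convert (t1.add t2).add t3 using 2
    rw [show (Real.pi : ℂ) * (p + 3) / 2 = φ + Real.pi / 2 + Real.pi by rw [hφ]; ring,
      Complex.sin_add_pi, Complex.sin_add_pi_div_two, hK, hsin2]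
    field_simp
    ring

theorem cosSeries_eq_cos_add_expMellin {p : ℂ} (hp : -2 < p.re) {x : ℝ} (hx : 0 < x) :
    cosSeries p x = Complex.cos (x + p * Real.pi / 2) +
      Complex.sin (Real.pi * p) / Real.pi * expMellin (p + 2) x := by
  have hU : IsOpen {q : ℂ | -2 < q.re} := isOpen_lt continuous_const Complex.continuous_re
  have hV : IsOpen {q : ℂ | -2 < q.re ∧ q.re < -1} :=
    hU.inter (isOpen_lt Complex.continuous_re continuous_const)
  have hf : AnalyticOnNhd ℂ (fun q : ℂ => cosSeries q x) {q : ℂ | -2 < q.re} :=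
    (differentiable_cosSeries_order hx).differentiableOn.analyticOnNhd hU
  have hg : AnalyticOnNhd ℂ (fun q : ℂ => Complex.cos (x + q * Real.pi / 2) +
      Complex.sin (Real.pi * q) / Real.pi * expMellin (q + 2) x) {q : ℂ | -2 < q.re} := by
    refine DifferentiableOn.analyticOnNhd (fun q hq => ?_) hU
    have hq' : -2 < q.re := hq
    refine DifferentiableAt.differentiableWithinAt (DifferentiableAt.add (by fun_prop)
      (DifferentiableAt.mul (by fun_prop) ?_))
    exact (differentiableAt_expMellin (s := q + 2) (by simp; linarith) hx).comp q
      (differentiableAt_id.add_const 2)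
  refine hf.eqOn_of_preconnected_of_eventuallyEq hg
    (convex_halfSpace_re_gt (-2)).isPreconnected (z₀ := ((-3 / 2 : ℝ) : ℂ))
    (by simp only [Set.mem_ofPred_eq, Complex.ofReal_re]; norm_num) ?_ hp
  filter_upwards [hV.mem_nhds (show ((-3 / 2 : ℝ) : ℂ) ∈ _ by
    simp only [Set.mem_ofPred_eq, Complex.ofReal_re]; norm_num)] with q hq
  exact cosSeries_eq_cos_add_expMellin_of_strip hq.1 hq.2 hx

theorem tendsto_cosSeries_sub_cos {p : ℂ} (hp : -2 < p.re) :
    Tendsto (fun x : ℝ => cosSeries p x - Complex.cos (x + p * Real.pi / 2)) atTop (𝓝 0) := by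
  have h := (tendsto_expMellin_atTop (s := p + 2) (by simp; linarith)).const_mul
    (Complex.sin (Real.pi * p) / Real.pi)
  rw [mul_zero] at h
  refine h.congr' ?_
  filter_upwards [eventually_gt_atTop 0] with x hx
  rw [cosSeries_eq_cos_add_expMellin hp hx]
  ring

/-! ### Low orders and gauge functions. -/

theorem cosSeries_eq_sum_add (p : ℂ) {z : ℂ} (hz : z ≠ 0) (n : ℕ) :
    cosSeries p z = ∑ i ∈ Finset.range n,
      (-1) ^ i * (z ^ (-p - ((2 * (i + 1) : ℕ) : ℂ)) /
        Complex.Gamma (1 - p - ((2 * (i + 1) : ℕ) : ℂ))) + (-1) ^ n * cosSeries (p + 2 * n) z := by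
  induction n with
  | zero => simp
  | succ n ih =>
    rw [ih, Finset.sum_range_succ]
    have h := cosSeries_eq_sub (p + 2 * (n + 1 : ℕ)) hz
    rw [show p + 2 * ((n + 1 : ℕ) : ℂ) - 2 = p + 2 * n by push_cast; ring,
      show -(p + 2 * ((n + 1 : ℕ) : ℂ)) = -p - ((2 * (n + 1) : ℕ) : ℂ) by push_cast; ring,
      show 1 - (p + 2 * ((n + 1 : ℕ) : ℂ)) = 1 - p - ((2 * (n + 1) : ℕ) : ℂ) by push_cast; ring] at h
    rw [h]
    ring

theorem cos_add_order_pi (p z : ℂ) (n : ℕ) :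
    Complex.cos (z + (p + 2 * n) * Real.pi / 2) =
      (-1) ^ n * Complex.cos (z + p * Real.pi / 2) := by
  rw [show z + (p + 2 * n) * Real.pi / 2 = z + p * Real.pi / 2 + n * Real.pi by ring]
  exact Complex.cos_antiperiodic.add_nat_mul_eq n

theorem IsGaugeFunction.zero (p : ℂ) : IsGaugeFunction p 0 := ⟨0, by simp⟩

theorem IsGaugeFunction.add {p : ℂ} {F G : ℂ → ℂ} (hF : IsGaugeFunction p F)
    (hG : IsGaugeFunction p G) : IsGaugeFunction p (F + G) := by
  obtain ⟨c, hc⟩ := hF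
  obtain ⟨d, hd⟩ := hG
  exact ⟨c + d, fun z => by simp [hc, hd, add_mul, Finset.sum_add_distrib]⟩

/-- If `l ≤ ⌊-Re p⌋₊` the power is itself a gauge term and is cancelled exactly; otherwise `Re p + l
> 0` and it decays. -/
theorem exists_gauge_add_cpow_tendsto_zero (p a : ℂ) {l : ℕ} (hl : 1 ≤ l) :
    ∃ G : ℂ → ℂ, IsGaugeFunction p G ∧
      Tendsto (fun x : ℝ => G x + a * (x : ℂ) ^ (-p - (l : ℂ))) atTop (𝓝 0) := by
  by_cases h : l ≤ ⌊-p.re⌋₊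
  · refine ⟨fun z => -a * z ^ (-p - (l : ℂ)), ⟨Pi.single l (-a), fun z => ?_⟩, by simp⟩
    rw [Finset.sum_eq_single l]
    · simp
    · intro j _ hj
      simp [Pi.single_eq_of_ne hj]
    · exact fun hn => absurd (Finset.mem_Icc.2 ⟨hl, h⟩) hn
  · refine ⟨0, IsGaugeFunction.zero p, ?_⟩
    have hlt : -p.re < l := Nat.lt_of_floor_lt (not_le.1 h)
    have ht : Tendsto (fun x : ℝ => ‖a‖ * x ^ (-(p.re + l))) atTop (𝓝 0) := by
      simpa using (tendsto_rpow_neg_atTop (y := p.re + l) (by linarith)).const_mul ‖a‖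
    refine squeeze_zero_norm' ?_ ht
    filter_upwards [eventually_gt_atTop 0] with x hx
    rw [Pi.zero_apply, zero_add, norm_mul, Complex.norm_cpow_eq_rpow_re_of_pos hx]
    simp only [Complex.sub_re, Complex.neg_re, Complex.natCast_re]
    rw [neg_add, sub_eq_add_neg]

theorem exists_gauge_add_sum_cpow_tendsto_zero (p : ℂ) (a : ℕ → ℂ) (l : ℕ → ℕ)
    (hl : ∀ i, 1 ≤ l i) (n : ℕ) :
    ∃ G : ℂ → ℂ, IsGaugeFunction p G ∧
      Tendsto (fun x : ℝ => G x + ∑ i ∈ Finset.range n, a i * (x : ℂ) ^ (-p - (l i : ℂ)))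
        atTop (𝓝 0) := by
  induction n with
  | zero => exact ⟨0, IsGaugeFunction.zero p, by simp⟩
  | succ n ih =>
    obtain ⟨F, hF, hF'⟩ := ih
    obtain ⟨G, hG, hG'⟩ := exists_gauge_add_cpow_tendsto_zero p (a n) (hl n)
    refine ⟨F + G, hF.add hG, ?_⟩
    have h := hF'.add hG'
    rw [add_zero] at h
    refine h.congr fun x => ?_
    rw [Finset.sum_range_succ, Pi.add_apply]
    ring

theorem exists_tendsto_cosSeries_sub_sum (q : ℂ) : ∃ n : ℕ,
    Tendsto (fun x : ℝ => cosSeries q x - ∑ i ∈ Finset.range n,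
      (-1) ^ i * ((x : ℂ) ^ (-q - ((2 * (i + 1) : ℕ) : ℂ)) /
        Complex.Gamma (1 - q - ((2 * (i + 1) : ℕ) : ℂ))) -
      Complex.cos (x + q * Real.pi / 2)) atTop (𝓝 0) := by
  obtain ⟨n, hn⟩ := exists_nat_gt (-q.re)
  have hn0 : (0 : ℝ) ≤ n := n.cast_nonneg
  refine ⟨n, ?_⟩
  have h := (tendsto_cosSeries_sub_cos (p := q + 2 * n) (by simp; linarith)).const_mul
    ((-1 : ℂ) ^ n)
  rw [mul_zero] at h
  refine h.congr' ?_
  filter_upwards [eventually_gt_atTop 0] with x hx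
  have hs : ((-1 : ℂ) ^ n) * (-1) ^ n = 1 := by rw [← mul_pow]; simp
  rw [cosSeries_eq_sum_add q (by exact_mod_cast hx.ne') n, cos_add_order_pi]
  linear_combination -Complex.cos (x + q * Real.pi / 2) * hs

/-- `d = 0` serves the cosine and `d = 1` the sine. The gauge order stays `p`, so the exponents
become `-p - (2(i+1) - d)`, with `2(i+1) - d ≥ 1` as a gauge function requires. -/
theorem exists_gauge_tendsto_cosSeries (p : ℂ) {d : ℕ} (hd : d ≤ 1) :
    ∃ G : ℂ → ℂ, IsGaugeFunction p G ∧
      Tendsto (fun x : ℝ => cosSeries (p - d) x + G x -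
        Complex.cos (x + (p - d) * Real.pi / 2)) atTop (𝓝 0) := by
  obtain ⟨n, hn⟩ := exists_tendsto_cosSeries_sub_sum (p - d)
  obtain ⟨G, hG, hG'⟩ := exists_gauge_add_sum_cpow_tendsto_zero p
    (fun i => (-1) ^ i / Complex.Gamma (1 - (p - d) - ((2 * (i + 1) : ℕ) : ℂ)))
    (fun i => 2 * (i + 1) - d) (fun i => by omega) n
  refine ⟨G, hG, ?_⟩
  have h := hn.add hG'
  rw [add_zero] at h
  refine h.congr fun x => ?_
  have hsum : ∀ i ∈ Finset.range n, (-1) ^ i / Complex.Gamma (1 - (p - d) -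
      ((2 * (i + 1) : ℕ) : ℂ)) * (x : ℂ) ^ (-p - ((2 * (i + 1) - d : ℕ) : ℂ)) =
      (-1) ^ i * ((x : ℂ) ^ (-(p - d) - ((2 * (i + 1) : ℕ) : ℂ)) /
        Complex.Gamma (1 - (p - d) - ((2 * (i + 1) : ℕ) : ℂ))) := by
    intro i _
    rw [Nat.cast_sub (by omega), show -p - (((2 * (i + 1) : ℕ) : ℂ) - d) =
      -(p - d) - ((2 * (i + 1) : ℕ) : ℂ) by ring]
    ring
  rw [Finset.sum_congr rfl hsum]
  ring

theorem cos_add_sub_one_mul_pi_div_two (p z : ℂ) :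
    Complex.cos (z + (p - 1) * Real.pi / 2) = Complex.sin (z + p * Real.pi / 2) := by
  rw [← Complex.cos_sub_pi_div_two]
  congr 1
  ring

theorem mainTheorem5 (p : ℂ) :
    -- the derivatives of order `p` of sine and cosine are given by convergent series
    (∀ z : ℂ, z ≠ 0 →
      HasSum (fun m : ℕ => (-1 : ℂ) ^ m * z ^ (2 * (m : ℂ) + 1 - p) /
        Complex.Gamma (2 * (m : ℂ) + 2 - p)) (complexOrderDeriv p Complex.sin z)) ∧
    (∀ z : ℂ, z ≠ 0 →
      HasSum (fun m : ℕ => (-1 : ℂ) ^ m * z ^ (2 * (m : ℂ) - p) /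
        Complex.Gamma (2 * (m : ℂ) + 1 - p)) (complexOrderDeriv p Complex.cos z)) ∧
    -- they approach the phase-shifted functions
    (-1 < p.re →
      Tendsto (fun x : ℝ => complexOrderDeriv p Complex.sin (x : ℂ) -
        Complex.sin ((x : ℂ) + p * (Real.pi : ℂ) / 2)) atTop (𝓝 0)) ∧
    (-2 < p.re →
      Tendsto (fun x : ℝ => complexOrderDeriv p Complex.cos (x : ℂ) -
        Complex.cos ((x : ℂ) + p * (Real.pi : ℂ) / 2)) atTop (𝓝 0)) ∧
    -- and at every order they do so up to a gauge function
    (∃ G : ℂ → ℂ, IsGaugeFunction p G ∧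
      Tendsto (fun x : ℝ => complexOrderDeriv p Complex.sin (x : ℂ) + G (x : ℂ) -
        Complex.sin ((x : ℂ) + p * (Real.pi : ℂ) / 2)) atTop (𝓝 0)) ∧
    (∃ G : ℂ → ℂ, IsGaugeFunction p G ∧
      Tendsto (fun x : ℝ => complexOrderDeriv p Complex.cos (x : ℂ) + G (x : ℂ) -
        Complex.cos ((x : ℂ) + p * (Real.pi : ℂ) / 2)) atTop (𝓝 0)) := by
  have hne : ∀ᶠ x : ℝ in atTop, (x : ℂ) ≠ 0 := by
    filter_upwards [eventually_gt_atTop 0] with x hx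
    exact_mod_cast hx.ne'
  refine ⟨fun z hz => ?_, fun z hz => hasSum_complexOrderDeriv_cos p hz, fun hp => ?_,
    fun hp => ?_, ?_, ?_⟩
  · refine (hasSum_complexOrderDeriv_sin p hz).congr_fun fun m => ?_
    rw [cosTerm, show 2 * (m : ℂ) - (p - 1) = 2 * m + 1 - p by ring,
      show 2 * (m : ℂ) + 1 - (p - 1) = 2 * m + 2 - p by ring]
  · refine (tendsto_cosSeries_sub_cos (p := p - 1) (by simp; linarith)).congr' ?_
    filter_upwards [hne] with x hx
    rw [complexOrderDeriv_sin p hx, cos_add_sub_one_mul_pi_div_two]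
  · refine (tendsto_cosSeries_sub_cos hp).congr' ?_
    filter_upwards [hne] with x hx
    rw [complexOrderDeriv_cos p hx]
  · obtain ⟨G, hG, h⟩ := exists_gauge_tendsto_cosSeries p (d := 1) le_rfl
    refine ⟨G, hG, h.congr' ?_⟩
    filter_upwards [hne] with x hx
    rw [complexOrderDeriv_sin p hx, Nat.cast_one, cos_add_sub_one_mul_pi_div_two]
  · obtain ⟨G, hG, h⟩ := exists_gauge_tendsto_cosSeries p (d := 0) zero_le_one
    refine ⟨G, hG, h.congr' ?_⟩
    filter_upwards [hne] with x hx
    rw [complexOrderDeriv_cos p hx, Nat.cast_zero, sub_zero]
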